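/- **Setting.** Let $V\subset H\subset V'$ be a Gelfand triple of real Hilbert spaces ($V$ densely and continuously imbedded in $H=H'$; the duality pairing $\langle\cdot,\cdot\rangle$ of $V$ and $V'$ extends the inner product of $H$), and let $D\subset W\subset X$ be real Banach spaces, with continuous imbeddings $D\subset V$, $W\subset H$, $X\subset V'$ compatible with these inclusions. Let $T>0$, let $1<p<\infty$ be fixed, and for each $w\in W$ let $A(w):D\to X$ be a linear operator. Assume: (i) For every $w\in W$, $-A(w)$, with domain $D$, generates an analytic semigroup on $X$. For all $1<q<\infty$ and $R>0$ there is $C_{q,R}<\infty$ such that for all $\|w\|_W\le R$ and $g\in L^q(0,T;X)$ the problem $\dot v+A(w)v=g$ on $(0,T]$, $v(0)=0$, has a solution $v\in W^{1,q}(0,T;X)\cap L^q(0,T;D)$, and the solution satisfies $\|\dot v\|_{L^q(0,T;X)}+\|A(w)v\|_{L^q(0,T;X)}\le C_{q,R}\|g\|_{L^q(0,T;X)}$. For every $R>0$ the graph norms $\|\cdot\|_X+\|A(w)\cdot\|_X$ are equivalent to $\|\cdot\|_D$, uniformly for $\|w\|_W\le R$. (ii) There is $C_p<\infty$ such that $\|v\|_{L^\infty(0,T;W)}\le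 C_p\bigl(\|\dot v\|_{L^p(0,T;X)}+\|v\|_{L^p(0,T;D)}\bigr)$ for all $v\in W^{1,p}(0,T;X)\cap L^p(0,T;D)$. (iii) $D$ is dense in $V$, each $A(w)$ extends to a bounded linear operator $A(w):V\to V'$, and for every $R>0$ there are $\alpha_R>0$, $M_R<\infty$ with $\alpha_R\|v\|_V^2\le\langle v,A(w)v\rangle\le M_R\|v\|_V^2$ for all $v\in V$ and $\|w\|_W\le R$. (iv) For all $\varepsilon,R>0$ there is $C_{\varepsilon,R}<\infty$ such that for all $v,w\in W$ with $W$-norm at most $R$ and all $z\in D$, $\|(A(v)-A(w))z\|_X\le\bigl(\varepsilon\|v-w\|_W+C_{\varepsilon,R}\|v-w\|_H\bigr)\|z\|_D$. (v) For all $\varepsilon,R>0$ there is $C_{\varepsilon,R}<\infty$ such that for all $v,w\in W$ with $W$-norm at most $R$ and $v-w\in V$, and all $z\in D$, $\|(A(v)-A(w))z\|_{V'}\le\bigl(\varepsilon\|v-w\|_V+C_{\varepsilon,R}\|v-w\|_H\bigr)\|z\|_D$. **Proposition 3.2.** In this setting, for all $K_1,K_2\ge0$ there are $C<\infty$ and $\delta_0>0$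 (depending only on $K_1$, $K_2$, $p$, $T$, and the given spaces and operators $A(\cdot)$) such that the following holds. Let $f:(0,T]\to X$, let $u_0\in X$, let $0<\delta\le\delta_0$, and let $d\in L^p(0,T;X)$ with $\|d\|_{L^p(0,T;X)}\le\delta$. Let $u\in W^{1,p}(0,T;X)\cap L^p(0,T;D)$ solve $$\dot u(t)+A(u(t))u(t)=f(t)\quad\text{for a.e. }t\in(0,T],\qquad u(0)=u_0,$$ and let $u^\star\in W^{1,\infty}(0,T;W)\cap L^p(0,T;D)$, with $\|u^\star\|_{W^{1,\infty}(0,T;W)}\le K_1$ and $\|u^\star\|_{L^p(0,T;D)}\le K_2$, solve $$\dot u^\star(t)+A(u^\star(t))u^\star(t)=f(t)+d(t)\quad\text{for a.e. }t\in(0,T],\qquad u^\star(0)=u_0.$$ Then $e=u-u^\star$ satisfies $$\|\dot e\|_{L^p(0,T;X)}+\|e\|_{L^p(0,T;D)}\le C\delta,\qquad \|e\|_{L^\infty(0,T;W)}\le C\delta .$$ -/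

import Mathlib

open MeasureTheory Filter Topology Set
open scoped ENNReal NNReal

noncomputable section

/-- The spaces `D, W, X` and `V, H, V'` of the abstract framework, with their continuous embeddings
```
V ⊂ H ⊂ V'
∪   ∪   ∪
D ⊂ W ⊂ X
```
(`V, H` are real Hilbert spaces, `V` is dense in `H`, and `V'` is the dual of `V`).
The embedding `H = H' ⊂ V'` is `h ↦ ⟪h, ·⟫_H`, so the pairing of `V'` and `V` restricts to the
inner product of `H`. Both squares commute. -/
structure GelfandFrame (D W X V H : Type*)
    [NormedAddCommGroup D] [NormedSpace ℝ D]
    [NormedAddCommGroup W] [NormedSpace ℝ W]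
    [NormedAddCommGroup X] [NormedSpace ℝ X]
    [NormedAddCommGroup V] [InnerProductSpace ℝ V]
    [NormedAddCommGroup H] [InnerProductSpace ℝ H] where
  /-- the embedding `V ⊂ H` -/
  VH : V →L[ℝ] H
  VH_injective : Function.Injective VH
  VH_dense : DenseRange VH
  /-- the embedding `D ⊂ W` -/
  DW : D →L[ℝ] W
  DW_injective : Function.Injective DW
  /-- the embedding `W ⊂ X` -/
  WX : W →L[ℝ] X
  WX_injective : Function.Injective WX
  /-- the embedding `D ⊂ V` -/
  DV : D →L[ℝ] V
  DV_injective : Function.Injective DV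
  /-- the embedding `W ⊂ H` -/
  WH : W →L[ℝ] H
  WH_injective : Function.Injective WH
  /-- the embedding `X ⊂ V'` -/
  XV' : X →L[ℝ] StrongDual ℝ V
  XV'_injective : Function.Injective XV'
  /-- `D ⊂ V ⊂ H` and `D ⊂ W ⊂ H` agree -/
  comm_left : ∀ u : D, VH (DV u) = WH (DW u)
  /-- `W ⊂ X ⊂ V'` and `W ⊂ H ⊂ V'` agree -/
  comm_right : ∀ (w : W) (v : V), XV' (WX w) v = inner ℝ (WH w) (VH v)

/-- Lebesgue measure on the time interval `(0, T]`. -/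
def timeMeasure (T : ℝ) : Measure ℝ := volume.restrict (Ioc 0 T)

/-- The open sector `{z ≠ 0 : |arg z| < θ}` of the complex plane. -/
def openSector (θ : ℝ) : Set ℂ := {z : ℂ | z ≠ 0 ∧ |z.arg| < θ}

section Semigroup

variable {X : Type*} [NormedAddCommGroup X] [NormedSpace ℝ X]

/-- Multiplication by the imaginary unit on the complexification `X ⊕ iX`, which is modelled by
`X × X` (`(x, y)` stands for `x + i y`): `i (x + i y) = -y + i x`. -/
def complexStructure (X : Type*) [NormedAddCommGroup X] [NormedSpace ℝ X] :
    (X × X) →L[ℝ] (X × X) :=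
  (-(ContinuousLinearMap.snd ℝ X X)).prod (ContinuousLinearMap.fst ℝ X X)

/-- `S` (considered on `[0, ∞)` only) is a strongly continuous semigroup on `X`. -/
structure IsC0Semigroup (S : ℝ → X →L[ℝ] X) : Prop where
  zero : S 0 = ContinuousLinearMap.id ℝ X
  add : ∀ s t : ℝ, 0 ≤ s → 0 ≤ t → S (s + t) = (S s).comp (S t)
  tendsto : ∀ x : X, Tendsto (fun t => S t x) (𝓝[>] 0) (𝓝 x)

/-- `S` is an analytic semigroup on the real Banach space `X`: a strongly continuous semigroup
whose complexification extends, to some sector around the positive half-line, to a holomorphic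
family `Φ` of bounded complex-linear operators on `X ⊕ iX` which has the semigroup property and
is strongly continuous at the origin of the sector. -/
structure IsAnalyticSemigroup (S : ℝ → X →L[ℝ] X) : Prop where
  c0 : IsC0Semigroup S
  extension : ∃ θ : ℝ, 0 < θ ∧ θ ≤ Real.pi / 2 ∧ ∃ Φ : ℂ → (X × X) →L[ℝ] (X × X),
    (∀ t : ℝ, 0 < t → Φ (t : ℂ) = (S t).prodMap (S t)) ∧
    (∀ z ∈ openSector θ,
      (Φ z).comp (complexStructure X) = (complexStructure X).comp (Φ z)) ∧
    (∀ z ∈ openSector θ, ∀ z' ∈ openSector θ, Φ (z + z') = (Φ z).comp (Φ z')) ∧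
    -- complex differentiability, with complex derivative `L`: `Φ'(z) h = (re h) L + (im h) i L`
    (∀ z ∈ openSector θ, ∃ L : (X × X) →L[ℝ] (X × X),
      HasFDerivAt Φ (Complex.reCLM.smulRight L +
        Complex.imCLM.smulRight ((complexStructure X).comp L)) z) ∧
    (∀ x : X × X, Tendsto (fun z => Φ z x) (𝓝[openSector θ] 0) (𝓝 x))

/-- `G ⊂ X × X` is the graph of the infinitesimal generator of `S`: `(x, y) ∈ G` iff
`(S(t) x - x) / t → y` as `t ↓ 0`. -/
def IsGeneratorGraph (S : ℝ → X →L[ℝ] X) (G : Set (X × X)) : Prop :=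
  ∀ x y : X, (x, y) ∈ G ↔ Tendsto (fun t : ℝ => t⁻¹ • (S t x - x)) (𝓝[>] 0) (𝓝 y)

end Semigroup

/-- `u ∈ W^{1,p}(0,T;E)` with derivative `u'`: both are in `L^p(0,T;E)` and `u` is the
(absolutely continuous) primitive of `u'` on `[0,T]`. So `u` is the continuous representative and
`u 0` is its initial value. -/
structure IsSobolev {E : Type*} [NormedAddCommGroup E] [NormedSpace ℝ E]
    (T : ℝ) (p : ℝ≥0∞) (u u' : ℝ → E) : Prop where
  memLp : MemLp u p (timeMeasure T)
  memLp_deriv : MemLp u' p (timeMeasure T)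
  eq_integral : ∀ t ∈ Icc 0 T, u t = u 0 + ∫ s in (0 : ℝ)..t, u' s

section Framework

variable {D W X V H : Type*}
  [NormedAddCommGroup D] [NormedSpace ℝ D]
  [NormedAddCommGroup W] [NormedSpace ℝ W]
  [NormedAddCommGroup X] [NormedSpace ℝ X]
  [NormedAddCommGroup V] [InnerProductSpace ℝ V]
  [NormedAddCommGroup H] [InnerProductSpace ℝ H]

namespace GelfandFrame

variable (E : GelfandFrame D W X V H)

/-- The embedding `D ⊂ X`. -/
def DX : D →L[ℝ] X := E.WX.comp E.DW

/-- `u ∈ W^{1,p}(0,T;X) ∩ L^p(0,T;D)`, where `u'` is the derivative of `u`, and `uD` is `u`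
regarded as an element of `L^p(0,T;D)`. -/
structure MemMaxReg (T : ℝ) (p : ℝ≥0∞) (u u' : ℝ → X) (uD : ℝ → D) : Prop where
  sobolev : IsSobolev T p u u'
  memLp : MemLp uD p (timeMeasure T)
  ae_eq : ∀ᵐ t ∂timeMeasure T, E.DX (uD t) = u t

/-- `u ∈ W^{1,∞}(0,T;W) ∩ L^p(0,T;D)`, where `u'` is the derivative of `u`, and `uD` is `u`
regarded as an element of `L^p(0,T;D)`. -/
structure MemLipReg (T : ℝ) (p : ℝ≥0∞) (u u' : ℝ → W) (uD : ℝ → D) : Prop where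
  sobolev : IsSobolev T ∞ u u'
  memLp : MemLp uD p (timeMeasure T)
  ae_eq : ∀ᵐ t ∂timeMeasure T, E.DW (uD t) = u t

/-- `u` solves `u' + B u = f` a.e. on `(0,T]`, `u(0) = 0`, in `W^{1,p}(0,T;X) ∩ L^p(0,T;D)`. -/
structure SolvesLinear (T : ℝ) (p : ℝ≥0∞) (B : D →ₗ[ℝ] X) (f : ℝ → X)
    (u u' : ℝ → X) (uD : ℝ → D) : Prop where
  mem : E.MemMaxReg T p u u' uD
  eqn : ∀ᵐ t ∂timeMeasure T, u' t + B (uD t) = f t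
  init : u 0 = 0

/-- *`W`-locally uniform maximal regularity.* For every `w`, `-A(w)` (with domain `D`) generates
an analytic semigroup on `X`. For `1 < p < ∞`, each problem `u' + A(w) u = f`, `u(0) = 0` with
`f ∈ L^p(0,T;X)` is solvable and its solution satisfies
`‖u'‖_{L^p(X)} + ‖A(w)u‖_{L^p(X)} ≤ C_{p,R} ‖f‖_{L^p(X)}`, with a constant that is uniform for
`‖w‖_W ≤ R`. The graph norms are equivalent to the norm of `D`, uniformly for `‖w‖_W ≤ R`. -/
structure UniformMaximalRegularity (A : W → D →ₗ[ℝ] X) (T : ℝ) : Prop where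
  generator : ∀ w : W, ∃ S : ℝ → X →L[ℝ] X, IsAnalyticSemigroup S ∧
    IsGeneratorGraph S {q | ∃ u : D, q = (E.DX u, -(A w u))}
  maxReg : ∀ p : ℝ≥0∞, 1 < p → p < ∞ → ∀ R : ℝ, 0 < R → ∃ C : ℝ≥0, ∀ w : W, ‖w‖ ≤ R →
    ∀ f : ℝ → X, MemLp f p (timeMeasure T) →
      (∃ u u' : ℝ → X, ∃ uD : ℝ → D, E.SolvesLinear T p (A w) f u u' uD) ∧
      ∀ (u u' : ℝ → X) (uD : ℝ → D), E.SolvesLinear T p (A w) f u u' uD →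
        eLpNorm u' p (timeMeasure T) + eLpNorm (fun t => A w (uD t)) p (timeMeasure T) ≤
          C * eLpNorm f p (timeMeasure T)
  graphNorm : ∀ R : ℝ, 0 < R → ∃ c C : ℝ, 0 < c ∧ 0 < C ∧ ∀ w : W, ‖w‖ ≤ R → ∀ u : D,
    c * ‖u‖ ≤ ‖E.DX u‖ + ‖A w u‖ ∧ ‖E.DX u‖ + ‖A w u‖ ≤ C * ‖u‖

/-- *Control of the `W`-norm by maximal regularity*: the continuous embedding
`W^{1,p}(0,T;X) ∩ L^p(0,T;D) ⊂ L^∞(0,T;W)`. -/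
def ControlsSupNorm (T : ℝ) (p : ℝ≥0∞) : Prop :=
  ∃ C : ℝ≥0, ∀ (u u' : ℝ → X) (uD : ℝ → D), E.MemMaxReg T p u u' uD →
    eLpNorm (fun t => E.DW (uD t)) ∞ (timeMeasure T) ≤
      C * (eLpNorm u' p (timeMeasure T) + eLpNorm uD p (timeMeasure T))

/-- *`V`-ellipticity*: `D` is dense in `V`, `A(w)` extends to a bounded linear operator
`Aext w : V → V'`, and this is uniformly elliptic for `‖w‖_W ≤ R`. -/
def UniformlyElliptic (A : W → D →ₗ[ℝ] X) : Prop :=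
  DenseRange E.DV ∧ ∃ Aext : W → V →L[ℝ] StrongDual ℝ V,
    (∀ (w : W) (u : D), Aext w (E.DV u) = E.XV' (A w u)) ∧
    ∀ R : ℝ, 0 < R → ∃ α M : ℝ, 0 < α ∧ ∀ w : W, ‖w‖ ≤ R → ∀ v : V,
      α * ‖v‖ ^ 2 ≤ Aext w v v ∧ Aext w v v ≤ M * ‖v‖ ^ 2

/-- *Operators with different arguments: `X`-norm estimate.* -/
def XNormEstimate (A : W → D →ₗ[ℝ] X) : Prop :=
  ∀ ε : ℝ, 0 < ε → ∀ R : ℝ, 0 < R → ∃ C : ℝ, ∀ v w : W, ‖v‖ ≤ R → ‖w‖ ≤ R → ∀ u : D,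
    ‖A v u - A w u‖ ≤ (ε * ‖v - w‖ + C * ‖E.WH (v - w)‖) * ‖u‖

/-- *Operators with different arguments: `V'`-norm estimate.* Since `W` need not be contained in
`V`, the estimate (which involves `‖v - w‖_V`) concerns those `v, w ∈ W` whose difference is an
element `z` of `V`. -/
def DualNormEstimate (A : W → D →ₗ[ℝ] X) : Prop :=
  ∀ ε : ℝ, 0 < ε → ∀ R : ℝ, 0 < R → ∃ C : ℝ, ∀ v w : W, ‖v‖ ≤ R → ‖w‖ ≤ R →
    ∀ z : V, E.VH z = E.WH (v - w) → ∀ u : D,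
      ‖E.XV' (A v u - A w u)‖ ≤ (ε * ‖z‖ + C * ‖E.WH (v - w)‖) * ‖u‖

end GelfandFrame

end Framework

end

/-! The error `e = u - u⋆` starts at zero. Fix a time `t` and freeze the operator at `u⋆(t)`. Then
on `(0, t]` `ė + A(u⋆(t)) e = -d + (A(u⋆(t)) - A(u⋆)) e - (A(u) - A(u⋆)) u`. On bounded sets `A` is
Lipschitz from `W` into the bounded operators `D → X`, and `u⋆` is Lipschitz in time with values in
`W`, so at time `r` the right-hand side is at most `‖d‖ + L (K₁ (t - r) + ‖e‖_W) ‖e‖_D + L ‖e‖_W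
‖u⋆‖_D`. Let `M t` be the maximal regularity norm of `e` on `(0, t]`; it controls `‖e‖_W` there.

For `s < t`, split the `L^p` norm of this bound at `s`. The part on `(0, s]` is at most `δ` plus a
multiple of `M s`. On `(s, t]` the factors of `M t` are small if `t - s`, the norm of `u⋆` in
`L^p(s,t;D)` and `M t` are small. Maximal regularity on all of `(0, t]`, which avoids a nonzero
initial value at `s`, then allows absorption of `M t` and gives `M t ≤ G (δ + M s)`
(`GelfandFrame.error_le_of_short_interval`).

The bounds on `u⋆` permit a fixed number `n` of such short intervals to cover `(0, T]`. By
continuity of `M`, its smallness persists for small `δ`, and iteration gives `M T ≤ (2G)^n δ`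
(`le_pow_mul_of_short_interval_estimate`). -/

section TimeMeasure

/-! ### Norms on time intervals and time shifts. -/

variable {F : Type*} [NormedAddCommGroup F]

instance isFiniteMeasure_timeMeasure (T : ℝ) : IsFiniteMeasure (timeMeasure T) := by
  unfold timeMeasure; infer_instance

theorem timeMeasure_mono {s t : ℝ} (hst : s ≤ t) : timeMeasure s ≤ timeMeasure t :=
  Measure.restrict_mono (Ioc_subset_Ioc_right hst) le_rfl

theorem timeMeasure_eq_add {s t : ℝ} (hs : 0 ≤ s) (hst : s ≤ t) :
    timeMeasure t = timeMeasure s + volume.restrict (Ioc s t) := by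
  unfold timeMeasure
  rw [← Measure.restrict_union (Ioc_disjoint_Ioc_of_le le_rfl) measurableSet_Ioc,
    Ioc_union_Ioc_eq_Ioc hs hst]

theorem ae_mem_timeMeasure (T : ℝ) : ∀ᵐ t ∂timeMeasure T, t ∈ Ioc 0 T :=
  ae_restrict_mem measurableSet_Ioc

/-- Reduces to `(a^p + b^p)^(1/p) ≤ a + b`. It serves to split a norm over `(0, t]` at an
intermediate time. -/
theorem eLpNorm_add_measure_le {α : Type*} {m : MeasurableSpace α} {p : ℝ≥0∞} (hp : 1 ≤ p)
    (hp' : p ≠ ∞) (f : α → F) (μ ν : Measure α) :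
    eLpNorm f p (μ + ν) ≤ eLpNorm f p μ + eLpNorm f p ν := by
  have h0 : p ≠ 0 := (zero_lt_one.trans_le hp).ne'
  have h1 : 1 ≤ p.toReal := by simpa using ENNReal.toReal_mono hp' hp
  have h2 : p.toReal ≠ 0 := by positivity
  simp only [eLpNorm_eq_lintegral_rpow_enorm_toReal h0 hp', lintegral_add_measure]
  refine le_trans (le_of_eq ?_) (ENNReal.rpow_add_rpow_le_add _ _ h1)
  simp only [← ENNReal.rpow_mul, one_div, inv_mul_cancel₀ h2, ENNReal.rpow_one]

theorem ae_norm_le_of_eLpNorm_top_le {α : Type*} {m : MeasurableSpace α} {μ : Measure α}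
    {f : α → F} {b : ℝ} (hb : 0 ≤ b) (h : eLpNorm f ∞ μ ≤ ENNReal.ofReal b) :
    ∀ᵐ x ∂μ, ‖f x‖ ≤ b := by
  rw [eLpNorm_exponent_top] at h
  filter_upwards [enorm_ae_le_eLpNormEssSup f μ] with x hx
  have := hx.trans h
  rwa [← ofReal_norm, ENNReal.ofReal_le_ofReal_iff hb] at this

/-- `g` started at time `τ` instead of time `0`, and extended by zero to earlier times. -/
noncomputable def delay (τ : ℝ) (g : ℝ → F) : ℝ → F := (Ioi τ).indicator fun s => g (s - τ)

theorem delay_of_le {τ s : ℝ} (g : ℝ → F) (h : s ≤ τ) : delay τ g s = 0 :=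
  indicator_of_notMem (by simpa using h) _

theorem delay_of_lt {τ s : ℝ} (g : ℝ → F) (h : τ < s) : delay τ g s = g (s - τ) :=
  indicator_of_mem (by simpa using h) _

theorem delay_add {τ s : ℝ} (g : ℝ → F) (h : 0 < s) : delay τ g (s + τ) = g s := by
  rw [delay_of_lt g (by linarith), add_sub_cancel_right]

theorem measurePreserving_sub_timeMeasure (τ T : ℝ) :
    MeasurePreserving (fun s => s - τ) (volume.restrict (Ioc τ T)) (timeMeasure (T - τ)) := by
  have := (measurePreserving_sub_right (volume : Measure ℝ) τ).restrict_preimage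
    (measurableSet_Ioc (a := 0) (b := T - τ))
  simpa [timeMeasure] using this

theorem restrict_Ioi_timeMeasure {τ T : ℝ} (h0 : 0 ≤ τ) :
    (timeMeasure T).restrict (Ioi τ) = volume.restrict (Ioc τ T) := by
  rw [timeMeasure, Measure.restrict_restrict measurableSet_Ioi]
  congr 1
  ext x
  simp only [mem_inter_iff, mem_Ioi, mem_Ioc]
  exact ⟨fun h => ⟨h.1, h.2.2⟩, fun h => ⟨h.1, h0.trans_lt h.1, h.2⟩⟩

theorem ae_timeMeasure_of_delay {τ T : ℝ} (h0 : 0 ≤ τ) {P : ℝ → Prop}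
    (h1 : ∀ s ≤ τ, P s) (h2 : ∀ᵐ s ∂timeMeasure (T - τ), P (s + τ)) :
    ∀ᵐ s ∂timeMeasure T, P s := by
  have h3 := (measurePreserving_sub_timeMeasure τ T).quasiMeasurePreserving.ae h2
  rw [← restrict_Ioi_timeMeasure h0, ae_restrict_iff' measurableSet_Ioi] at h3
  filter_upwards [h3] with s hs
  rcases le_or_gt s τ with h | h
  · exact h1 s h
  · simpa using hs h

theorem eLpNorm_delay {τ T : ℝ} (h0 : 0 ≤ τ) {g : ℝ → F} (p : ℝ≥0∞)
    (hg : AEStronglyMeasurable g (timeMeasure (T - τ))) :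
    eLpNorm (delay τ g) p (timeMeasure T) = eLpNorm g p (timeMeasure (T - τ)) := by
  rw [delay, eLpNorm_indicator_eq_eLpNorm_restrict measurableSet_Ioi, restrict_Ioi_timeMeasure h0]
  exact eLpNorm_comp_measurePreserving hg (measurePreserving_sub_timeMeasure τ T)

theorem memLp_delay {τ T : ℝ} (h0 : 0 ≤ τ) {g : ℝ → F} {p : ℝ≥0∞}
    (hg : MemLp g p (timeMeasure (T - τ))) : MemLp (delay τ g) p (timeMeasure T) := by
  rw [delay, memLp_indicator_iff_restrict measurableSet_Ioi, restrict_Ioi_timeMeasure h0]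
  exact hg.comp_measurePreserving (measurePreserving_sub_timeMeasure τ T)

/-! ### Calculus of Sobolev functions in time. -/

variable [NormedSpace ℝ F]

theorem IsSobolev.mono {s t : ℝ} (hst : s ≤ t) {p : ℝ≥0∞} {u u' : ℝ → F}
    (h : IsSobolev t p u u') : IsSobolev s p u u' where
  memLp := h.memLp.mono_measure (timeMeasure_mono hst)
  memLp_deriv := h.memLp_deriv.mono_measure (timeMeasure_mono hst)
  eq_integral r hr := h.eq_integral r ⟨hr.1, hr.2.trans hst⟩

theorem IsSobolev.mono_exponent {T : ℝ} {p q : ℝ≥0∞} (hpq : p ≤ q) {u u' : ℝ → F}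
    (h : IsSobolev T q u u') : IsSobolev T p u u' where
  memLp := h.memLp.mono_exponent hpq
  memLp_deriv := h.memLp_deriv.mono_exponent hpq
  eq_integral := h.eq_integral

theorem IsSobolev.integrable_deriv {T : ℝ} {p : ℝ≥0∞} (hp : 1 ≤ p) {u u' : ℝ → F}
    (h : IsSobolev T p u u') : Integrable u' (timeMeasure T) :=
  h.memLp_deriv.integrable hp

theorem IsSobolev.intervalIntegrable_deriv {T : ℝ} {p : ℝ≥0∞} (hp : 1 ≤ p) {u u' : ℝ → F}
    (h : IsSobolev T p u u') {s t : ℝ} (hs : 0 ≤ s) (hst : s ≤ t) (ht : t ≤ T) :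
    IntervalIntegrable u' volume s t := by
  rw [intervalIntegrable_iff_integrableOn_Ioc_of_le hst]
  exact IntegrableOn.mono_set (h.integrable_deriv hp) (Ioc_subset_Ioc hs ht)

theorem IsSobolev.clm_comp {G : Type*} [NormedAddCommGroup G] [NormedSpace ℝ G]
    [CompleteSpace F] [CompleteSpace G]
    {T : ℝ} {p : ℝ≥0∞} (hp : 1 ≤ p) {u u' : ℝ → F} (h : IsSobolev T p u u') (L : F →L[ℝ] G) :
    IsSobolev T p (fun t => L (u t)) (fun t => L (u' t)) where
  memLp := L.comp_memLp' h.memLp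
  memLp_deriv := L.comp_memLp' h.memLp_deriv
  eq_integral t ht := by
    rw [h.eq_integral t ht, map_add,
      L.intervalIntegral_comp_comm (h.intervalIntegrable_deriv hp le_rfl ht.1 ht.2)]

theorem IsSobolev.sub {T : ℝ} {p : ℝ≥0∞} (hp : 1 ≤ p) {u u' v v' : ℝ → F}
    (hu : IsSobolev T p u u') (hv : IsSobolev T p v v') :
    IsSobolev T p (fun t => u t - v t) (fun t => u' t - v' t) where
  memLp := hu.memLp.sub hv.memLp
  memLp_deriv := hu.memLp_deriv.sub hv.memLp_deriv
  eq_integral t ht := by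
    rw [hu.eq_integral t ht, hv.eq_integral t ht, intervalIntegral.integral_sub
      (hu.intervalIntegrable_deriv hp le_rfl ht.1 ht.2)
      (hv.intervalIntegrable_deriv hp le_rfl ht.1 ht.2)]
    abel

/-- The vanishing initial value prevents a jump at `τ`, so the extension by zero remains a
primitive. -/
theorem IsSobolev.delay {τ T : ℝ} (h0 : 0 ≤ τ) {p : ℝ≥0∞} {u u' : ℝ → F}
    (h : IsSobolev (T - τ) p u u') (hu : u 0 = 0) :
    IsSobolev T p (delay τ u) (delay τ u') where
  memLp := memLp_delay h0 h.memLp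
  memLp_deriv := memLp_delay h0 h.memLp_deriv
  eq_integral r hr := by
    rw [delay_of_le u h0, zero_add, intervalIntegral.integral_of_le hr.1]
    rcases le_or_gt r τ with hrτ | hrτ
    · rw [delay_of_le u hrτ, setIntegral_congr_fun measurableSet_Ioc
        (fun x hx => delay_of_le u' (hx.2.trans hrτ))]
      simp
    · have h1 : Ioc 0 r ∩ Ioi τ = Ioc τ r := by
        ext x
        simp only [mem_inter_iff, mem_Ioi, mem_Ioc]
        exact ⟨fun h => ⟨h.2, h.1.2⟩, fun h => ⟨⟨h0.trans_lt h.1, h.2⟩, h.1⟩⟩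
      have h2 := h.eq_integral (r - τ) ⟨by linarith, by linarith [hr.2]⟩
      rw [hu, zero_add] at h2
      rw [delay_of_lt u hrτ, h2, _root_.delay, setIntegral_indicator measurableSet_Ioi, h1,
        ← intervalIntegral.integral_of_le hrτ.le, intervalIntegral.integral_comp_sub_right, sub_self]

theorem IsSobolev.norm_sub_le {T b : ℝ} {u u' : ℝ → F} (h : IsSobolev T ∞ u u')
    (hb : ∀ᵐ t ∂timeMeasure T, ‖u' t‖ ≤ b) {s t : ℝ} (hs : 0 ≤ s) (hst : s ≤ t) (ht : t ≤ T) :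
    ‖u t - u s‖ ≤ b * (t - s) := by
  have h1 : u t - u s = ∫ r in s..t, u' r := by
    rw [h.eq_integral t ⟨hs.trans hst, ht⟩, h.eq_integral s ⟨hs, hst.trans ht⟩,
      ← intervalIntegral.integral_add_adjacent_intervals
        (h.intervalIntegrable_deriv le_top le_rfl hs (hst.trans ht))
        (h.intervalIntegrable_deriv le_top hs hst ht)]
    abel
  rw [h1, ← abs_of_nonneg (sub_nonneg.2 hst)]
  refine intervalIntegral.norm_integral_le_of_norm_le_const_ae ?_
  rw [timeMeasure, ae_restrict_iff' measurableSet_Ioc] at hb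
  filter_upwards [hb] with r hr hr'
  rw [uIoc_of_le hst] at hr'
  exact hr ⟨hs.trans_lt hr'.1, hr'.2.trans ht⟩

/-- Pointwise `u` is bounded by the `L^1` norm of `u'`. Hölder costs `T^(1 - 1/p)`, and the norm of
a constant contributes `T^(1/p)`. -/
theorem IsSobolev.eLpNorm_le_of_zero {T : ℝ} (hT : 0 ≤ T) {p : ℝ≥0∞} (hp : 1 ≤ p)
    {u u' : ℝ → F} (h : IsSobolev T p u u') (hu : u 0 = 0) :
    eLpNorm u p (timeMeasure T) ≤ ENNReal.ofReal T * eLpNorm u' p (timeMeasure T) := by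
  have hvol : timeMeasure T univ = ENNReal.ofReal T := by simp [timeMeasure]
  rcases hT.eq_or_lt with rfl | hT
  · simp [timeMeasure]
  have hT0 : ENNReal.ofReal T ≠ 0 := by simpa using hT
  have h1 : ∀ᵐ t ∂timeMeasure T, ‖u t‖ₑ ≤ eLpNorm u' 1 (timeMeasure T) := by
    filter_upwards [ae_mem_timeMeasure T] with t ht
    rw [h.eq_integral t ⟨ht.1.le, ht.2⟩, hu, zero_add, intervalIntegral.integral_of_le ht.1.le,
      eLpNorm_one_eq_lintegral_enorm]
    exact (enorm_integral_le_lintegral_enorm _).trans (lintegral_mono' (timeMeasure_mono ht.2) le_rfl)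
  have h2 := eLpNorm_le_eLpNorm_mul_rpow_measure_univ hp h.memLp_deriv.aestronglyMeasurable
  rw [hvol] at h2
  have h3 : eLpNorm u p (timeMeasure T) ≤
      eLpNorm (fun _ : ℝ => eLpNorm u' 1 (timeMeasure T)) p (timeMeasure T) :=
    eLpNorm_mono_enorm_ae (by simpa using h1)
  refine h3.trans ?_
  rw [eLpNorm_const _ (zero_lt_one.trans_le hp).ne' (by
    rw [← Measure.measure_univ_ne_zero, hvol]; exact hT0), hvol, enorm_eq_self]
  refine (mul_le_mul_left h2 _).trans (le_of_eq ?_)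
  rw [mul_assoc, ← ENNReal.rpow_add _ _ hT0 ENNReal.ofReal_ne_top, mul_comm]
  simp

end TimeMeasure

/-! ### Maximal regularity with constants uniform over subintervals. -/

namespace GelfandFrame

variable {D W X V H : Type*}
  [NormedAddCommGroup D] [NormedSpace ℝ D]
  [NormedAddCommGroup W] [NormedSpace ℝ W]
  [NormedAddCommGroup X] [NormedSpace ℝ X]
  [NormedAddCommGroup V] [InnerProductSpace ℝ V]
  [NormedAddCommGroup H] [InnerProductSpace ℝ H]
  {E : GelfandFrame D W X V H} {A : W → D →ₗ[ℝ] X}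

theorem MemMaxReg.mono {s t : ℝ} (hst : s ≤ t) {p : ℝ≥0∞} {u u' : ℝ → X} {uD : ℝ → D}
    (h : E.MemMaxReg t p u u' uD) : E.MemMaxReg s p u u' uD where
  sobolev := h.sobolev.mono hst
  memLp := h.memLp.mono_measure (timeMeasure_mono hst)
  ae_eq := ae_mono (timeMeasure_mono hst) h.ae_eq

theorem MemMaxReg.sub {T : ℝ} {p : ℝ≥0∞} (hp : 1 ≤ p) {u u' v v' : ℝ → X} {uD vD : ℝ → D}
    (hu : E.MemMaxReg T p u u' uD) (hv : E.MemMaxReg T p v v' vD) :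
    E.MemMaxReg T p (fun t => u t - v t) (fun t => u' t - v' t) (fun t => uD t - vD t) where
  sobolev := hu.sobolev.sub hp hv.sobolev
  memLp := hu.memLp.sub hv.memLp
  ae_eq := by
    filter_upwards [hu.ae_eq, hv.ae_eq] with t h1 h2
    rw [map_sub, h1, h2]

theorem MemMaxReg.delay {τ T : ℝ} (h0 : 0 ≤ τ) {p : ℝ≥0∞} {u u' : ℝ → X} {uD : ℝ → D}
    (h : E.MemMaxReg (T - τ) p u u' uD) (hu : u 0 = 0) :
    E.MemMaxReg T p (delay τ u) (delay τ u') (delay τ uD) where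
  sobolev := h.sobolev.delay h0 hu
  memLp := memLp_delay h0 h.memLp
  ae_eq := by
    refine ae_timeMeasure_of_delay h0 (fun s hs => ?_) ?_
    · rw [delay_of_le _ hs, delay_of_le _ hs, map_zero]
    · filter_upwards [h.ae_eq, ae_mem_timeMeasure (T - τ)] with s hs hs0
      rw [delay_add _ hs0.1, delay_add _ hs0.1, hs]

theorem MemLipReg.memMaxReg [CompleteSpace W] [CompleteSpace X] {T : ℝ} {p : ℝ≥0∞} (hp : 1 ≤ p)
    {u u' : ℝ → W} {uD : ℝ → D} (h : E.MemLipReg T p u u' uD) :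
    E.MemMaxReg T p (fun t => E.WX (u t)) (fun t => E.WX (u' t)) uD where
  sobolev := (h.sobolev.mono_exponent le_top).clm_comp hp E.WX
  memLp := h.memLp
  ae_eq := by
    filter_upwards [h.ae_eq] with t ht
    rw [← ht]; rfl

/-- Maximal regularity on the subintervals `(0, t]`, for functions with zero initial value: it
follows from the estimate on `(0, T]` by a time shift. -/
theorem UniformMaximalRegularity.estimate {T : ℝ} (h : E.UniformMaximalRegularity A T)
    {p : ℝ≥0∞} (hp : 1 < p) (hp' : p < ∞) {R : ℝ} (hR : 0 < R) :
    ∃ C : ℝ≥0, ∀ w : W, ‖w‖ ≤ R → ∀ t ∈ Icc 0 T, ∀ (v v' : ℝ → X) (vD : ℝ → D),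
      E.MemMaxReg t p v v' vD → v 0 = 0 →
      eLpNorm v' p (timeMeasure t) + eLpNorm vD p (timeMeasure t) ≤
        C * eLpNorm (fun s => v' s + A w (vD s)) p (timeMeasure t) := by
  obtain ⟨C, hC⟩ := h.maxReg p hp hp' R hR
  obtain ⟨c, C', hc, hC', hg⟩ := h.graphNorm R hR
  refine ⟨C + c⁻¹.toNNReal * ((T.toNNReal + 1) * C), fun w hw t ht v v' vD hv hv0 => ?_⟩
  have hτ : 0 ≤ T - t := sub_nonneg.2 ht.2
  -- The upper graph norm bound makes `A w` continuous on `D`, so `A w (vD ·)` is measurable and in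
  -- `L^p`.
  let B : D →L[ℝ] X := (A w).mkContinuous C' fun u => by
    have := (hg w hw u).2
    linarith [norm_nonneg (E.DX u)]
  have hAv : MemLp (fun s => A w (vD s)) p (timeMeasure t) := B.comp_memLp' hv.memLp
  have hf : MemLp (fun s => v' s + A w (vD s)) p (timeMeasure t) :=
    hv.sobolev.memLp_deriv.add hAv
  have key : eLpNorm v' p (timeMeasure t) + eLpNorm (fun s => A w (vD s)) p (timeMeasure t) ≤
      C * eLpNorm (fun s => v' s + A w (vD s)) p (timeMeasure t) := by
    have htT : t = T - (T - t) := by ring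
    rw [htT] at hf hv hAv
    -- The frozen operator does not depend on time, so the equation is invariant under the shift.
    have hs : E.SolvesLinear T p (A w) (delay (T - t) fun s => v' s + A w (vD s))
        (delay (T - t) v) (delay (T - t) v') (delay (T - t) vD) := by
      refine ⟨hv.delay hτ hv0, ?_, delay_of_le _ hτ⟩
      refine Eventually.of_forall fun s => ?_
      rcases le_or_gt s (T - t) with h | h
      · simp [delay_of_le _ h]
      · simp [delay_of_lt _ h]
    have h1 := (hC w hw _ (memLp_delay hτ hf)).2 _ _ _ hs
    have h2 : (fun s => A w (delay (T - t) vD s)) = delay (T - t) fun s => A w (vD s) := by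
      ext s
      rcases le_or_gt s (T - t) with h | h
      · simp [delay_of_le _ h]
      · simp [delay_of_lt _ h]
    rw [h2, eLpNorm_delay hτ p hf.1, eLpNorm_delay hτ p hAv.1,
      eLpNorm_delay hτ p hv.sobolev.memLp_deriv.1] at h1
    rwa [← htT] at h1
  set N := eLpNorm (fun s => v' s + A w (vD s)) p (timeMeasure t)
  have h1 : eLpNorm v p (timeMeasure t) ≤ T.toNNReal * eLpNorm v' p (timeMeasure t) :=
    (hv.sobolev.eLpNorm_le_of_zero ht.1 hp.le hv0).trans
      (mul_le_mul_left (ENNReal.ofReal_le_ofReal ht.2) _)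
  -- The lower graph norm bound recovers the norm of `D`; its lower-order term is controlled by
  -- `h1`.
  have h2 : eLpNorm vD p (timeMeasure t) ≤ ENNReal.ofReal c⁻¹ *
      (eLpNorm v p (timeMeasure t) + eLpNorm (fun s => A w (vD s)) p (timeMeasure t)) := by
    rw [← eLpNorm_norm v, ← eLpNorm_norm fun s => A w (vD s)]
    refine le_trans ?_ (mul_le_mul_right
      (eLpNorm_add_le hv.sobolev.memLp.1.norm hAv.1.norm hp.le) _)
    refine eLpNorm_le_mul_eLpNorm_of_ae_le_mul ?_ p
    filter_upwards [hv.ae_eq] with s hs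
    have h3 := (hg w hw (vD s)).1
    rw [hs] at h3
    rw [Pi.add_apply, Real.norm_of_nonneg (by positivity), inv_mul_eq_div, le_div_iff₀ hc]
    linarith
  have h3 : eLpNorm v' p (timeMeasure t) ≤ C * N := le_self_add.trans key
  have h4 : eLpNorm (fun s => A w (vD s)) p (timeMeasure t) ≤ C * N := le_add_self.trans key
  have hcc : ENNReal.ofReal c⁻¹ = (c⁻¹.toNNReal : ℝ≥0∞) := rfl
  calc _ ≤ C * N + ENNReal.ofReal c⁻¹ * (T.toNNReal * (C * N) + C * N) := by
        gcongr
        exact h2.trans (by gcongr; exact h1.trans (by gcongr))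
    _ = _ := by
        rw [hcc]; push_cast; ring

/-- The embedding into `L^∞(W)` on the subintervals `(0, t]`, for functions with zero initial
value. -/
theorem ControlsSupNorm.estimate {T : ℝ} {p : ℝ≥0∞} (h : E.ControlsSupNorm T p) :
    ∃ C : ℝ≥0, ∀ t ∈ Icc 0 T, ∀ (v v' : ℝ → X) (vD : ℝ → D),
      E.MemMaxReg t p v v' vD → v 0 = 0 →
      eLpNorm (fun s => E.DW (vD s)) ∞ (timeMeasure t) ≤
        C * (eLpNorm v' p (timeMeasure t) + eLpNorm vD p (timeMeasure t)) := by
  obtain ⟨C, hC⟩ := h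
  refine ⟨C, fun t ht v v' vD hv hv0 => ?_⟩
  have hτ : 0 ≤ T - t := sub_nonneg.2 ht.2
  have htT : t = T - (T - t) := by ring
  rw [htT] at hv
  have h1 := hC _ _ _ (hv.delay hτ hv0)
  have h2 : (fun s => E.DW (delay (T - t) vD s)) = delay (T - t) fun s => E.DW (vD s) := by
    ext s
    rcases le_or_gt s (T - t) with h | h
    · simp [delay_of_le _ h]
    · simp [delay_of_lt _ h]
  rw [h2, eLpNorm_delay hτ ∞ (E.DW.continuous.comp_aestronglyMeasurable hv.memLp.1),
    eLpNorm_delay hτ p hv.memLp.1, eLpNorm_delay hτ p hv.sobolev.memLp_deriv.1] at h1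
  rwa [← htT] at h1

/-- `A` is Lipschitz continuous on bounded sets of `W`. -/
theorem XNormEstimate.lipschitz (h : E.XNormEstimate A) {R : ℝ} (hR : 0 < R) :
    ∃ L : ℝ, 0 < L ∧ ∀ v w : W, ‖v‖ ≤ R → ‖w‖ ≤ R → ∀ u : D,
      ‖A v u - A w u‖ ≤ L * ‖v - w‖ * ‖u‖ := by
  -- The choice `ε = 1` suffices, since the `H`-norm is dominated by the `W`-norm.
  obtain ⟨C, hC⟩ := h 1 one_pos R hR
  refine ⟨1 + |C| * ‖E.WH‖, by positivity, fun v w hv hw u => (hC v w hv hw u).trans ?_⟩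
  gcongr
  have h1 : C * ‖E.WH (v - w)‖ ≤ |C| * (‖E.WH‖ * ‖v - w‖) := by
    gcongr
    · exact le_abs_self C
    · exact E.WH.le_opNorm _
  linarith

end GelfandFrame

/-! ### Continuation over finitely many short intervals. -/

/-- A continuation argument: a Gronwall type estimate that is available on short intervals (as
measured by `Φ`) and only as long as `M ≤ ρ` yields a bound of `M` by small data. -/
theorem le_pow_mul_of_short_interval_estimate {T ρ η C δ : ℝ} {M Φ : ℝ → ℝ}
    (hM : ContinuousOn M (Icc 0 T)) (hM0 : M 0 = 0)
    (hΦ : ContinuousOn Φ (Icc 0 T)) (hΦ0 : Φ 0 = 0) (hΦ_mono : MonotoneOn Φ (Icc 0 T))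
    (hΦ_le : ∀ t ∈ Icc 0 T, t ≤ Φ t) (hC : 1 ≤ C) (hδ : 0 < δ) (hη : 0 < η)
    (hstep : ∀ s t, 0 ≤ s → s ≤ t → t ≤ T → Φ t - Φ s ≤ η → M t ≤ ρ → M t ≤ C * (δ + M s))
    (n : ℕ) (hn : (2 * C) ^ n * δ < ρ) :
    ∀ k ≤ n, ∀ t ∈ Icc 0 T, Φ t ≤ k * η → M t ≤ (2 * C) ^ k * δ := by
  have h2C : 1 ≤ 2 * C := by linarith
  intro k
  induction k with
  | zero =>
    intro _ t ht h
    have h1 := hΦ_le t ht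
    have h2 : t = 0 := le_antisymm (by simp at h; linarith) ht.1
    rw [h2, hM0]
    positivity
  | succ k ih =>
    intro hk t ht h
    have ih := ih (by omega)
    have hpow : (2 * C) ^ k * δ ≤ (2 * C) ^ (k + 1) * δ := by
      gcongr
      omega
    have hpow' : (2 * C) ^ (k + 1) * δ < ρ := by
      refine lt_of_le_of_lt ?_ hn
      gcongr
    have hδk : δ ≤ (2 * C) ^ k * δ := le_mul_of_one_le_left hδ.le (one_le_pow₀ h2C)
    rcases le_or_gt (Φ t) (k * η) with hk' | hk'
    · exact (ih t ht hk').trans hpow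
    -- At a time `s` with `Φ s = k * η` the previous bound holds, and `Φ` grows by at most `η` up to
    -- `t`.
    obtain ⟨s, hs, hsΦ⟩ := intermediate_value_Icc ht.1
      (hΦ.mono (Icc_subset_Icc_right ht.2)) ⟨by rw [hΦ0]; positivity, hk'.le⟩
    have hMs : M s ≤ (2 * C) ^ k * δ := ih s ⟨hs.1, hs.2.trans ht.2⟩ hsΦ.le
    have hbound : ∀ r ∈ Icc s t, M r ≤ ρ → M r ≤ (2 * C) ^ (k + 1) * δ := by
      intro r hr hrρ
      have h1 := hΦ_mono ⟨hs.1.trans hr.1, hr.2.trans ht.2⟩ ht hr.2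
      push_cast at h
      have h2 := hstep s r hs.1 hr.1 (hr.2.trans ht.2) (by linarith) hrρ
      calc M r ≤ C * (δ + M s) := h2
        _ ≤ C * ((2 * C) ^ k * δ + (2 * C) ^ k * δ) := by gcongr
        _ = _ := by ring
    rcases le_or_gt (M t) ρ with hρ | hρ
    · exact hbound t ⟨hs.2, le_rfl⟩ hρ
    -- To exceed `ρ`, `M` would have to take the value `ρ` at some `r`, where `hbound` already
    -- forces `M r < ρ`.
    · obtain ⟨r, hr, hrM⟩ := intermediate_value_Icc hs.2
        (hM.mono (Icc_subset_Icc hs.1 ht.2)) ⟨by linarith, hρ.le⟩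
      have := hbound r hr hrM.le
      linarith

/-! ### Integral bounds and continuity in the endpoint. -/

section LpBounds

variable {F G G₁ G₂ : Type*} [NormedAddCommGroup F] [NormedAddCommGroup G]
  [NormedAddCommGroup G₁] [NormedAddCommGroup G₂]

theorem eLpNorm_le_ofReal_of_ae_norm_le {α : Type*} {m : MeasurableSpace α} {μ : Measure α}
    {p : ℝ≥0∞} (hp : 1 ≤ p) {f : α → F} {d : α → G} {g : α → G₁} {h : α → G₂}
    (hd : AEStronglyMeasurable d μ) (hg : AEStronglyMeasurable g μ)
    (hh : AEStronglyMeasurable h μ) {a b c₀ c₁ c₂ : ℝ} (ha : 0 ≤ a) (hb : 0 ≤ b)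
    (h₀ : 0 ≤ c₀) (h₁ : 0 ≤ c₁) (h₂ : 0 ≤ c₂)
    (hdc : eLpNorm d p μ ≤ ENNReal.ofReal c₀) (hgc : eLpNorm g p μ ≤ ENNReal.ofReal c₁)
    (hhc : eLpNorm h p μ ≤ ENNReal.ofReal c₂)
    (hf : ∀ᵐ x ∂μ, ‖f x‖ ≤ ‖d x‖ + a * ‖g x‖ + b * ‖h x‖) :
    eLpNorm f p μ ≤ ENNReal.ofReal (c₀ + a * c₁ + b * c₂) := by
  have e₁ : eLpNorm (a • fun x => ‖g x‖) p μ ≤ ENNReal.ofReal (a * c₁) := by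
    rw [eLpNorm_const_smul, eLpNorm_norm, ENNReal.ofReal_mul ha, Real.enorm_of_nonneg ha]
    gcongr
  have e₂ : eLpNorm (b • fun x => ‖h x‖) p μ ≤ ENNReal.ofReal (b * c₂) := by
    rw [eLpNorm_const_smul, eLpNorm_norm, ENNReal.ofReal_mul hb, Real.enorm_of_nonneg hb]
    gcongr
  calc eLpNorm f p μ
      ≤ eLpNorm (((fun x => ‖d x‖) + a • fun x => ‖g x‖) + b • fun x => ‖h x‖) p μ :=
        eLpNorm_mono_ae_real (by simpa using hf)
    _ ≤ eLpNorm (fun x => ‖d x‖) p μ + eLpNorm (a • fun x => ‖g x‖) p μ +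
          eLpNorm (b • fun x => ‖h x‖) p μ :=
        (eLpNorm_add_le (hd.norm.add (hg.norm.const_smul a)) (hh.norm.const_smul b) hp).trans
          (by gcongr; exact eLpNorm_add_le hd.norm (hg.norm.const_smul a) hp)
    _ ≤ ENNReal.ofReal c₀ + ENNReal.ofReal (a * c₁) + ENNReal.ofReal (b * c₂) := by
        rw [eLpNorm_norm]; gcongr
    _ = _ := by
        rw [ENNReal.ofReal_add (by positivity) (by positivity),
          ENNReal.ofReal_add h₀ (by positivity)]

theorem MeasureTheory.MemLp.intervalIntegrable_norm_rpow {T : ℝ} {p : ℝ≥0∞} (hp : 1 ≤ p)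
    (hp' : p ≠ ∞) {g : ℝ → F} (hg : MemLp g p (timeMeasure T)) {s t : ℝ} (hs : 0 ≤ s)
    (hst : s ≤ t) (ht : t ≤ T) :
    IntervalIntegrable (fun r => ‖g r‖ ^ p.toReal) volume s t := by
  rw [intervalIntegrable_iff_integrableOn_Ioc_of_le hst]
  exact IntegrableOn.mono_set (hg.integrable_norm_rpow (zero_lt_one.trans_le hp).ne' hp')
    (Ioc_subset_Ioc hs ht)

theorem MeasureTheory.MemLp.eLpNorm_restrict_Ioc {T : ℝ} {p : ℝ≥0∞} (hp : 1 ≤ p)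
    (hp' : p ≠ ∞) {g : ℝ → F} (hg : MemLp g p (timeMeasure T)) {s t : ℝ} (hs : 0 ≤ s)
    (hst : s ≤ t) (ht : t ≤ T) :
    eLpNorm g p (volume.restrict (Ioc s t)) =
      ENNReal.ofReal ((∫ r in s..t, ‖g r‖ ^ p.toReal) ^ p.toReal⁻¹) := by
  have h : MemLp g p (volume.restrict (Ioc s t)) :=
    hg.mono_measure (Measure.restrict_mono (Ioc_subset_Ioc hs ht) le_rfl)
  rw [h.eLpNorm_eq_integral_rpow_norm (zero_lt_one.trans_le hp).ne' hp',
    intervalIntegral.integral_of_le hst]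

theorem continuousOn_primitive_norm_rpow {T : ℝ} (hT : 0 ≤ T) {p : ℝ≥0∞} (hp : 1 ≤ p)
    (hp' : p ≠ ∞) {g : ℝ → F} (hg : MemLp g p (timeMeasure T)) :
    ContinuousOn (fun t => ∫ r in (0 : ℝ)..t, ‖g r‖ ^ p.toReal) (Icc 0 T) := by
  rw [← uIcc_of_le hT]
  refine intervalIntegral.continuousOn_primitive_interval ?_
  rw [uIcc_of_le hT, integrableOn_Icc_iff_integrableOn_Ioc]
  exact hg.integrable_norm_rpow (zero_lt_one.trans_le hp).ne' hp'

/-- For finite `p` the norm is a power of a primitive. This provides the continuity of `M` that the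
continuation argument needs. -/
theorem continuousOn_toReal_eLpNorm {T : ℝ} (hT : 0 ≤ T) {p : ℝ≥0∞} (hp : 1 ≤ p)
    (hp' : p ≠ ∞) {g : ℝ → F} (hg : MemLp g p (timeMeasure T)) :
    ContinuousOn (fun t => (eLpNorm g p (timeMeasure t)).toReal) (Icc 0 T) := by
  refine ContinuousOn.congr ((continuousOn_primitive_norm_rpow hT hp hp' hg).rpow_const
    (p := p.toReal⁻¹) fun _ _ => Or.inr (by positivity)) fun t ht => ?_
  rw [timeMeasure, hg.eLpNorm_restrict_Ioc hp hp' le_rfl ht.1 ht.2, ENNReal.toReal_ofReal]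
  have : 0 ≤ ∫ r in (0 : ℝ)..t, ‖g r‖ ^ p.toReal :=
    intervalIntegral.integral_nonneg ht.1 fun _ _ => by positivity
  positivity

end LpBounds

/-! ### The error equation and its estimate on short intervals. -/

namespace GelfandFrame

variable {D W X V H : Type*}
  [NormedAddCommGroup D] [NormedSpace ℝ D]
  [NormedAddCommGroup W] [NormedSpace ℝ W]
  [NormedAddCommGroup X] [NormedSpace ℝ X]
  [NormedAddCommGroup V] [InnerProductSpace ℝ V]
  [NormedAddCommGroup H] [InnerProductSpace ℝ H]
  {E : GelfandFrame D W X V H} {A : W → D →ₗ[ℝ] X}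

/-- Subtract the two equations and compare both operators with `A (E.DW xs)`. Writing `x = (x - xs)
+ xs` leaves terms that contain only the error and the perturbed solution `xs`. -/
theorem norm_residual_le {L R : ℝ} (hL0 : 0 ≤ L)
    (hL : ∀ v w : W, ‖v‖ ≤ R → ‖w‖ ≤ R → ∀ x : D, ‖A v x - A w x‖ ≤ L * ‖v - w‖ * ‖x‖)
    {x xs : D} {y ys f d : X} {w : W} (h : y + A (E.DW x) x = f)
    (hs : ys + A (E.DW xs) xs = f + d) (hw : ‖w‖ ≤ R) (hx : ‖E.DW x‖ ≤ R)
    (hxs : ‖E.DW xs‖ ≤ R) :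
    ‖(y - ys) + A w (x - xs)‖ ≤ ‖d‖ + L * (‖w - E.DW xs‖ + ‖E.DW (x - xs)‖) * ‖x - xs‖ +
      L * ‖E.DW (x - xs)‖ * ‖xs‖ := by
  have h1 : (y - ys) + A w (x - xs) =
      -d + (A w (x - xs) - A (E.DW xs) (x - xs)) + -(A (E.DW x) x - A (E.DW xs) x) := by
    have hy : y = f - A (E.DW x) x := eq_sub_of_add_eq h
    have hys : ys = f + d - A (E.DW xs) xs := eq_sub_of_add_eq hs
    rw [hy, hys, map_sub, map_sub]
    abel
  have h2 := hL _ _ hw hxs (x - xs)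
  have h3 := hL _ _ hx hxs x
  rw [← map_sub E.DW] at h3
  have h4 : ‖x‖ ≤ ‖x - xs‖ + ‖xs‖ := by simpa using norm_add_le (x - xs) xs
  rw [h1]
  calc _ ≤ ‖d‖ + L * ‖w - E.DW xs‖ * ‖x - xs‖ +
        L * ‖E.DW (x - xs)‖ * (‖x - xs‖ + ‖xs‖) := by
        refine (norm_add₃_le).trans ?_
        rw [norm_neg, norm_neg]
        gcongr
        exact h3.trans (by gcongr)
    _ = _ := by ring

/-- The error estimate on a short interval `(s, t]` in terms of the error on `(0, s]`. -/
theorem error_le_of_short_interval {T : ℝ} {p : ℝ≥0∞} (hp : 1 ≤ p) (hp' : p ≠ ∞) {C S : ℝ≥0}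
    {L K₁ K₂ R η ρ δ : ℝ} (hL0 : 0 ≤ L) (hK₁ : 0 ≤ K₁) (hK₂ : 0 ≤ K₂) (hη0 : 0 ≤ η)
    (hδ0 : 0 ≤ δ)
    (hC : ∀ w : W, ‖w‖ ≤ R → ∀ t ∈ Icc 0 T, ∀ (v v' : ℝ → X) (vD : ℝ → D),
      E.MemMaxReg t p v v' vD → v 0 = 0 →
      eLpNorm v' p (timeMeasure t) + eLpNorm vD p (timeMeasure t) ≤
        C * eLpNorm (fun s => v' s + A w (vD s)) p (timeMeasure t))
    (hS : ∀ t ∈ Icc 0 T, ∀ (v v' : ℝ → X) (vD : ℝ → D),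
      E.MemMaxReg t p v v' vD → v 0 = 0 →
      eLpNorm (fun s => E.DW (vD s)) ∞ (timeMeasure t) ≤
        S * (eLpNorm v' p (timeMeasure t) + eLpNorm vD p (timeMeasure t)))
    {e e' : ℝ → X} {eD usD : ℝ → D} {us : ℝ → W} {d : ℝ → X}
    (he : E.MemMaxReg T p e e' eD) (he0 : e 0 = 0)
    (husD : MemLp usD p (timeMeasure T)) (hd : MemLp d p (timeMeasure T))
    (hus : ∀ t ∈ Icc 0 T, ‖us t‖ ≤ R)
    (hus_lip : ∀ s t, 0 ≤ s → s ≤ t → t ≤ T → ‖us t - us s‖ ≤ K₁ * (t - s))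
    (hres : ∀ᵐ r ∂timeMeasure T, ∀ w : W, ‖w‖ ≤ R → ‖E.DW (eD r)‖ ≤ 1 →
      ‖e' r + A w (eD r)‖ ≤ ‖d r‖ + L * (‖w - us r‖ + ‖E.DW (eD r)‖) * ‖eD r‖ +
        L * ‖E.DW (eD r)‖ * ‖usD r‖)
    (hK₂' : eLpNorm usD p (timeMeasure T) ≤ ENNReal.ofReal K₂)
    (hδ : eLpNorm d p (timeMeasure T) ≤ ENNReal.ofReal δ)
    (hρ : S * ρ ≤ 1) (hsmall : C * (L * (K₁ * η + S * ρ + S * η)) ≤ 1 / 2)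
    {M : ℝ → ℝ}
    (hM : M = fun t => (eLpNorm e' p (timeMeasure t) + eLpNorm eD p (timeMeasure t)).toReal)
    {s t : ℝ} (hs : 0 ≤ s) (hst : s ≤ t) (ht : t ≤ T) (hη : t - s ≤ η)
    (hη' : eLpNorm usD p (volume.restrict (Ioc s t)) ≤ ENNReal.ofReal η) (hMt : M t ≤ ρ) :
    M t ≤ (1 + 4 * C + 2 * C * (L * (K₁ * T + 1 + S * K₂))) * (δ + M s) := by
  have hfin : ∀ r ≤ T,
      eLpNorm e' p (timeMeasure r) + eLpNorm eD p (timeMeasure r) = ENNReal.ofReal (M r) := by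
    intro r hr
    have h := he.mono hr
    rw [hM, ENNReal.ofReal_toReal]
    exact ENNReal.add_ne_top.2 ⟨h.sobolev.memLp_deriv.2.ne, h.memLp.2.ne⟩
  have hM0 : ∀ r, 0 ≤ M r := fun r => by rw [hM]; positivity
  have hMst : M s ≤ M t := by
    rw [← ENNReal.ofReal_le_ofReal_iff (hM0 t), ← hfin s (hst.trans ht), ← hfin t ht]
    gcongr <;> exact timeMeasure_mono hst
  have hsup : ∀ r ∈ Icc 0 T, ∀ᵐ x ∂timeMeasure r, ‖E.DW (eD x)‖ ≤ S * M r := by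
    intro r hr
    refine ae_norm_le_of_eLpNorm_top_le (mul_nonneg S.2 (hM0 r)) ?_
    have := hS r hr e e' eD (he.mono hr.2) he0
    rwa [hfin r hr.2, ← ENNReal.ofReal_coe_nnreal, ← ENNReal.ofReal_mul S.coe_nonneg] at this
  have hSt : S * M t ≤ S * ρ := by gcongr
  have hSs : S * M s ≤ S * M t := by gcongr
  have hμ1 : timeMeasure s ≤ timeMeasure T := timeMeasure_mono (hst.trans ht)
  have hμ2 : volume.restrict (Ioc s t) ≤ timeMeasure T :=
    Measure.restrict_mono (Ioc_subset_Ioc hs ht) le_rfl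
  have hμ3 : volume.restrict (Ioc s t) ≤ timeMeasure t :=
    Measure.restrict_mono (Ioc_subset_Ioc_left hs) le_rfl
  have heD : ∀ r ≤ T, eLpNorm eD p (timeMeasure r) ≤ ENNReal.ofReal (M r) := fun r hr =>
    le_add_self.trans (hfin r hr).le
  have hKT : K₁ * (t - s) ≤ K₁ * η := by gcongr
  -- The bound `b` stays free: it is `S * M s` on `(0, s]` and `S * M t` on `(s, t]`.
  have hres' : ∀ᵐ r ∂timeMeasure T, ∀ b : ℝ, r ≤ t → b ≤ 1 → ‖E.DW (eD r)‖ ≤ b →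
      ‖e' r + A (us t) (eD r)‖ ≤ ‖d r‖ + L * (K₁ * (t - r) + b) * ‖eD r‖ +
        L * b * ‖usD r‖ := by
    filter_upwards [hres, ae_mem_timeMeasure T] with r hr hr0 b hrt hb hbr
    have h1 := hr (us t) (hus t ⟨hs.trans hst, ht⟩) (hbr.trans hb)
    have h2 := hus_lip r t hr0.1.le hrt ht
    exact h1.trans (by gcongr)
  have hA : eLpNorm (fun r => e' r + A (us t) (eD r)) p (timeMeasure s) ≤
      ENNReal.ofReal (δ + L * (K₁ * T + 1) * M s + L * (S * M s) * K₂) := by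
    refine eLpNorm_le_ofReal_of_ae_norm_le hp (hd.1.mono_measure hμ1)
      (he.memLp.1.mono_measure hμ1) (husD.1.mono_measure hμ1) ?_ ?_ hδ0 (hM0 s) hK₂
      ((eLpNorm_mono_measure _ hμ1).trans hδ) (heD s (hst.trans ht))
      ((eLpNorm_mono_measure _ hμ1).trans hK₂') ?_
    · have : 0 ≤ T := hs.trans (hst.trans ht)
      positivity
    · have := hM0 s
      positivity
    · filter_upwards [ae_mono hμ1 hres', hsup s ⟨hs, hst.trans ht⟩, ae_mem_timeMeasure s]
        with r hr hr1 hr2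
      refine (hr _ (hr2.2.trans hst) (by linarith) hr1).trans ?_
      have : t - r ≤ T := by linarith [hr2.1]
      gcongr
      linarith
  have hB : eLpNorm (fun r => e' r + A (us t) (eD r)) p (volume.restrict (Ioc s t)) ≤
      ENNReal.ofReal (δ + L * (K₁ * η + S * ρ) * M t + L * (S * M t) * η) := by
    have hρ0 : 0 ≤ ρ := (hM0 t).trans hMt
    refine eLpNorm_le_ofReal_of_ae_norm_le hp (hd.1.mono_measure hμ2)
      (he.memLp.1.mono_measure hμ2) (husD.1.mono_measure hμ2) ?_ ?_ hδ0 (hM0 t) hη0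
      ((eLpNorm_mono_measure _ hμ2).trans hδ)
      ((eLpNorm_mono_measure _ hμ3).trans (heD t ht)) hη' ?_
    · positivity
    · have := hM0 t
      positivity
    · filter_upwards [ae_mono hμ2 hres', ae_mono hμ3 (hsup t ⟨hs.trans hst, ht⟩),
        ae_restrict_mem measurableSet_Ioc] with r hr hr1 hr2
      refine (hr _ hr2.2 (by linarith) hr1).trans ?_
      have : t - r ≤ η := by linarith [hr2.1]
      gcongr
  have hmain := hC (us t) (hus t ⟨hs.trans hst, ht⟩) t ⟨hs.trans hst, ht⟩ e e' eD (he.mono ht) he0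
  rw [hfin t ht, timeMeasure_eq_add hs hst] at hmain
  have hρ0 : 0 ≤ ρ := (hM0 t).trans hMt
  have hT0 : 0 ≤ T := hs.trans (hst.trans ht)
  have hMs0 := hM0 s
  have hMt0 := hM0 t
  have hmain' : ENNReal.ofReal (M t) ≤ ENNReal.ofReal (C *
      ((δ + L * (K₁ * T + 1) * M s + L * (S * M s) * K₂) +
        (δ + L * (K₁ * η + S * ρ) * M t + L * (S * M t) * η))) := by
    rw [ENNReal.ofReal_mul C.coe_nonneg, ENNReal.ofReal_coe_nnreal,
      ENNReal.ofReal_add (by positivity) (by positivity)]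
    refine hmain.trans ?_
    gcongr
    exact (eLpNorm_add_measure_le hp hp' _ _ _).trans (add_le_add hA hB)
  rw [ENNReal.ofReal_le_ofReal_iff (by positivity)] at hmain'
  -- Absorption into the left-hand side doubles the remaining constants; `δ` occurs once on each
  -- piece, whence `4 * C`.
  have h5 : C * (L * (K₁ * η + S * ρ + S * η)) * M t ≤ 1 / 2 * M t := by gcongr
  have hC0 : (0 : ℝ) ≤ C := C.2
  have h6 : M t ≤ 4 * C * δ + 2 * C * (L * (K₁ * T + 1 + S * K₂)) * M s := by
    linarith
  refine h6.trans ?_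
  have h7 : 0 ≤ C * (L * (K₁ * T + 1 + S * K₂)) * δ := by positivity
  have h8 : 0 ≤ C * M s := by positivity
  linarith

end GelfandFrame

/-! ### Choice of constants and conclusion. -/

theorem proposition3p2
    {D W X V H : Type*}
    [NormedAddCommGroup D] [NormedSpace ℝ D] [CompleteSpace D]
    [NormedAddCommGroup W] [NormedSpace ℝ W] [CompleteSpace W]
    [NormedAddCommGroup X] [NormedSpace ℝ X] [CompleteSpace X]
    [NormedAddCommGroup V] [InnerProductSpace ℝ V] [CompleteSpace V]
    [NormedAddCommGroup H] [InnerProductSpace ℝ H] [CompleteSpace H]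
    (E : GelfandFrame D W X V H) (A : W → D →ₗ[ℝ] X)
    (T : ℝ) (hT : 0 < T) (p : ℝ≥0∞) (hp_one : 1 < p) (hp_top : p < ∞)
    (h_maxReg : E.UniformMaximalRegularity A T)
    (h_sup : E.ControlsSupNorm T p)
    (h_ell : E.UniformlyElliptic A)
    (h_X : E.XNormEstimate A)
    (h_dual : E.DualNormEstimate A)
    -- bounds for `‖u⋆‖_{W^{1,∞}(0,T;W)}` and `‖u⋆‖_{L^p(0,T;D)}`
    (K₁ K₂ : ℝ≥0) :
    ∃ C δ₀ : ℝ≥0, 0 < δ₀ ∧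
      ∀ (f d : ℝ → X) (u₀ : X)
        -- the solution `u`, its derivative, and `u` as a `D`-valued function
        (u u' : ℝ → X) (uD : ℝ → D)
        -- the perturbed solution `u⋆`, its derivative, and `u⋆` as a `D`-valued function
        (us us' : ℝ → W) (usD : ℝ → D) (δ : ℝ≥0),
        E.MemMaxReg T p u u' uD →
        (∀ᵐ t ∂timeMeasure T, u' t + A (E.DW (uD t)) (uD t) = f t) →
        u 0 = u₀ →
        E.MemLipReg T p us us' usD →
        (∀ᵐ t ∂timeMeasure T, E.WX (us' t) + A (us t) (usD t) = f t + d t) →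
        E.WX (us 0) = u₀ →
        eLpNorm us ∞ (timeMeasure T) + eLpNorm us' ∞ (timeMeasure T) ≤ K₁ →
        eLpNorm usD p (timeMeasure T) ≤ K₂ →
        MemLp d p (timeMeasure T) →
        0 < δ → δ ≤ δ₀ →
        eLpNorm d p (timeMeasure T) ≤ δ →
        eLpNorm (fun t => u' t - E.WX (us' t)) p (timeMeasure T) +
            eLpNorm (fun t => uD t - usD t) p (timeMeasure T) ≤ C * δ ∧
          eLpNorm (fun t => E.DW (uD t - usD t)) ∞ (timeMeasure T) ≤ C * δ := by
  have hp1 : 1 ≤ p := hp_one.le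
  have hp' : p ≠ ∞ := hp_top.ne
  have hp0 : 0 < p.toReal := ENNReal.toReal_pos (zero_lt_one.trans hp_one).ne' hp'
  -- `K₁ + K₁ * T` bounds `‖u⋆(t)‖_W` at every `t`; the extra `1` leaves room for the error, so that
  -- `u` lies in the same ball.
  have hR : (0 : ℝ) < K₁ + K₁ * T + 1 := by positivity
  obtain ⟨C, hC⟩ := h_maxReg.estimate hp_one hp_top hR
  obtain ⟨S, hS⟩ := h_sup.estimate
  obtain ⟨L, hL0, hL⟩ := h_X.lipschitz hR
  set R : ℝ := K₁ + K₁ * T + 1 with hR_def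
  have hC0 : (0 : ℝ) ≤ C := C.coe_nonneg
  have hS0 : (0 : ℝ) ≤ S := S.coe_nonneg
  have hK₁0 : (0 : ℝ) ≤ K₁ := K₁.coe_nonneg
  have hK₂0 : (0 : ℝ) ≤ K₂ := K₂.coe_nonneg
  -- `η` bounds three quantities at once: the interval length, the norm of `u⋆` in `L^p(s,t;D)`, and
  -- `M` (as the threshold `ρ`).
  set η : ℝ := 1 / (4 * (C + 1) * (L + 1) * (K₁ + S + 1)) with hη_def
  have hη0 : 0 < η := by positivity
  have hsmall : C * (L * (K₁ * η + S * η + S * η)) ≤ 1 / 2 := by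
    have : C * (L * (K₁ * η + S * η + S * η)) =
        C * L * (K₁ + 2 * S) / (4 * (C + 1) * (L + 1) * (K₁ + S + 1)) := by
      rw [hη_def]; ring
    rw [this, div_le_div_iff₀ (by positivity) two_pos]
    calc C * L * (K₁ + 2 * S) * 2 ≤ (C + 1) * (L + 1) * (2 * (K₁ + S + 1)) * 2 := by
          gcongr <;> linarith
      _ = _ := by ring
  have hSη : S * η ≤ 1 := by
    rw [hη_def, mul_one_div, div_le_one (by positivity)]
    calc (S : ℝ) ≤ 1 * 1 * 1 * (K₁ + S + 1) := by linarith
      _ ≤ _ := by gcongr <;> linarith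
  -- An increment of `Φ` (time plus the integral of `‖u⋆‖_D^p`) of at most `η'` meets both the
  -- length bound and the `L^p` bound.
  set η' : ℝ := min η (η ^ p.toReal) with hη'_def
  have hη'0 : 0 < η' := lt_min hη0 (by positivity)
  set n : ℕ := ⌈(T + (K₂ : ℝ) ^ p.toReal) / η'⌉₊ with hn_def
  set G : ℝ := 1 + 4 * C + 2 * C * (L * (K₁ * T + 1 + S * K₂)) with hG_def
  have hG1 : 1 ≤ G := by
    have : 0 ≤ 4 * C + 2 * C * (L * (K₁ * T + 1 + S * K₂)) := by positivity
    linarith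
  have ha : 0 < (2 * G) ^ n := by positivity
  -- The factor `2` in the second witness gives the strict inequality `(2 * G) ^ n * δ < η`; the
  -- factor `1 + S` covers both conclusions.
  refine ⟨(1 + S) * ((2 * G) ^ n).toNNReal, (η / (2 * (2 * G) ^ n)).toNNReal,
    by rw [Real.toNNReal_pos]; positivity, ?_⟩
  intro f d u₀ u u' uD us us' usD δ hu hequ hu0 hus hequs hus0 hK₁ hK₂ hd hδ hδ₀ hdδ
  have hδ0 : (0 : ℝ) < δ := hδ
  have hnδ : (2 * G) ^ n * δ < η := by
    have h1 : (δ : ℝ) ≤ η / (2 * (2 * G) ^ n) := by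
      have := NNReal.coe_le_coe.2 hδ₀
      rwa [Real.coe_toNNReal _ (by positivity)] at this
    rw [le_div_iff₀ (by positivity)] at h1
    nlinarith
  have he := hu.sub hp1 (hus.memMaxReg hp1)
  have he0 : u 0 - E.WX (us 0) = 0 := by rw [hu0, hus0, sub_self]
  have hus_bd : ∀ᵐ t ∂timeMeasure T, ‖us t‖ ≤ K₁ :=
    ae_norm_le_of_eLpNorm_top_le hK₁0 (by simpa using le_self_add.trans hK₁)
  have hus'_bd : ∀ᵐ t ∂timeMeasure T, ‖us' t‖ ≤ K₁ :=
    ae_norm_le_of_eLpNorm_top_le hK₁0 (by simpa using le_add_self.trans hK₁)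
  have hlip : ∀ s t, 0 ≤ s → s ≤ t → t ≤ T → ‖us t - us s‖ ≤ K₁ * (t - s) :=
    fun s t h0 hst ht => hus.sobolev.norm_sub_le hus'_bd h0 hst ht
  have husR : ∀ t ∈ Icc 0 T, ‖us t‖ ≤ K₁ + K₁ * T := by
    have : NeBot (ae (timeMeasure T)) := by
      rw [ae_neBot, ← Measure.measure_univ_ne_zero]
      simpa [timeMeasure] using hT
    -- The essential bound holds at some `r`, and Lipschitz continuity carries it to every time.
    obtain ⟨r, hr, hr0⟩ := (hus_bd.and (ae_mem_timeMeasure T)).exists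
    intro t ht
    have h1 : ‖us t - us r‖ ≤ K₁ * T := by
      rcases le_total r t with h | h
      · exact (hlip r t hr0.1.le h ht.2).trans (by gcongr; linarith [hr0.1, ht.2])
      · rw [norm_sub_rev]
        exact (hlip t r ht.1 h hr0.2).trans (by gcongr; linarith [hr0.2, ht.1])
    have h2 := norm_add_le (us t - us r) (us r)
    rw [sub_add_cancel] at h2
    linarith
  have hres : ∀ᵐ r ∂timeMeasure T, ∀ w : W, ‖w‖ ≤ R → ‖E.DW (uD r - usD r)‖ ≤ 1 →
      ‖(u' r - E.WX (us' r)) + A w (uD r - usD r)‖ ≤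
        ‖d r‖ + L * (‖w - us r‖ + ‖E.DW (uD r - usD r)‖) * ‖uD r - usD r‖ +
        L * ‖E.DW (uD r - usD r)‖ * ‖usD r‖ := by
    filter_upwards [hequ, hequs, hus.ae_eq, ae_mem_timeMeasure T] with r h1 h2 h3 h4 w hw h5
    have h6 := husR r ⟨h4.1.le, h4.2⟩
    rw [← h3] at h2 h6 ⊢
    have h7 : ‖E.DW (uD r)‖ ≤ R := by
      have := norm_add_le (E.DW (uD r - usD r)) (E.DW (usD r))
      rw [← map_add, sub_add_cancel] at this
      linarith
    exact GelfandFrame.norm_residual_le hL0.le hL h1 h2 hw h7 (by linarith)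
  set M : ℝ → ℝ := fun t => (eLpNorm (fun t => u' t - E.WX (us' t)) p (timeMeasure t) +
    eLpNorm (fun t => uD t - usD t) p (timeMeasure t)).toReal with hM_def
  set Φ : ℝ → ℝ := fun t => t + ∫ r in (0 : ℝ)..t, ‖usD r‖ ^ p.toReal with hΦ_def
  have hint := fun s t hs hst ht =>
    hus.memLp.intervalIntegrable_norm_rpow hp1 hp' (s := s) (t := t) hs hst ht
  have hnonneg : ∀ s t, s ≤ t → 0 ≤ ∫ r in s..t, ‖usD r‖ ^ p.toReal := fun s t hst =>
    intervalIntegral.integral_nonneg hst fun _ _ => by positivity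
  have hΦ_sub : ∀ s t, 0 ≤ s → s ≤ t → t ≤ T →
      Φ t - Φ s = (t - s) + ∫ r in s..t, ‖usD r‖ ^ p.toReal := by
    intro s t hs hst ht
    have := intervalIntegral.integral_add_adjacent_intervals (hint 0 s le_rfl hs (hst.trans ht))
      (hint s t hs hst ht)
    simp only [hΦ_def, ← this]
    ring
  have hΦT : Φ T ≤ n * η' := by
    have h1 := hus.memLp.eLpNorm_restrict_Ioc hp1 hp' le_rfl hT.le le_rfl
    have h2 := hK₂
    rw [timeMeasure, h1, ← ENNReal.ofReal_coe_nnreal, ENNReal.ofReal_le_ofReal_iff hK₂0,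
      Real.rpow_inv_le_iff_of_pos (hnonneg 0 T hT.le) hK₂0 hp0] at h2
    have h3 := Nat.le_ceil ((T + (K₂ : ℝ) ^ p.toReal) / η')
    rw [div_le_iff₀ hη'0] at h3
    exact (add_le_add le_rfl h2).trans h3
  have hMT : M T ≤ (2 * G) ^ n * δ := by
    refine le_pow_mul_of_short_interval_estimate (T := T) (ρ := η) (η := η') (Φ := Φ)
      ?_ ?_ ?_ ?_ ?_ ?_ hG1 hδ0 hη'0 ?_ n hnδ n le_rfl T ⟨hT.le, le_rfl⟩ hΦT
    · refine ((continuousOn_toReal_eLpNorm hT.le hp1 hp' he.sobolev.memLp_deriv).add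
        (continuousOn_toReal_eLpNorm hT.le hp1 hp' he.memLp)).congr fun t ht => ?_
      have h := he.mono ht.2
      exact ENNReal.toReal_add h.sobolev.memLp_deriv.2.ne h.memLp.2.ne
    · simp [hM_def, timeMeasure]
    · exact continuousOn_id.add (continuousOn_primitive_norm_rpow hT.le hp1 hp' hus.memLp)
    · simp [hΦ_def]
    · intro s hs t ht hst
      have h1 := hΦ_sub s t hs.1 hst ht.2
      have h2 := hnonneg s t hst
      linarith
    · exact fun t ht => le_add_of_nonneg_right (hnonneg 0 t ht.1)
    · intro s t hs hst ht hΦη hMρ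
      rw [hΦ_sub s t hs hst ht] at hΦη
      have h1 := hnonneg s t hst
      have h2 : η' ≤ η := min_le_left _ _
      have h3 : η' ≤ η ^ p.toReal := min_le_right _ _
      refine GelfandFrame.error_le_of_short_interval hp1 hp' hL0.le hK₁0 hK₂0 hη0.le hδ0.le hC hS
        he he0 hus.memLp hd (fun t ht => (husR t ht).trans (by linarith)) hlip hres
        (by simpa using hK₂) (by simpa using hdδ) hSη hsmall hM_def hs hst ht (by linarith) ?_ hMρ
      rw [hus.memLp.eLpNorm_restrict_Ioc hp1 hp' hs hst ht]
      refine ENNReal.ofReal_le_ofReal ?_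
      rw [Real.rpow_inv_le_iff_of_pos h1 hη0.le hp0]
      linarith
  have hfinal : eLpNorm (fun t => u' t - E.WX (us' t)) p (timeMeasure T) +
      eLpNorm (fun t => uD t - usD t) p (timeMeasure T) ≤ ((2 * G) ^ n).toNNReal * δ := by
    rw [← ENNReal.ofReal_toReal
      (ENNReal.add_ne_top.2 ⟨he.sobolev.memLp_deriv.2.ne, he.memLp.2.ne⟩)]
    refine (ENNReal.ofReal_le_ofReal hMT).trans (le_of_eq ?_)
    rw [ENNReal.ofReal_mul ha.le, ENNReal.ofReal_coe_nnreal]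
    rfl
  have hsup := hS T ⟨hT.le, le_rfl⟩ _ _ _ he he0
  push_cast
  constructor
  · refine hfinal.trans ?_
    gcongr
    exact le_mul_of_one_le_left zero_le le_self_add
  · refine hsup.trans ?_
    rw [mul_assoc]
    gcongr
    exact le_add_self
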